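/- Let $X$ be a real locally convex topological vector space with topological dual $X^*$. Let $P\subset X$ be a nonempty convex polyhedron, i.e. a nonempty set of the form $P=\{x\in X \mid f_i(x)\le b_i,\ i=1,\dots,k\}$ with finitely many $f_i\in X^*$, $b_i\in\mathbb R$. Let $\Omega\subset X$ be a nonempty convex set whose quasi-relative interior $$\operatorname{qri}(\Omega):=\{x\in\Omega \mid \overline{\operatorname{cone}(\Omega-x)}\ \text{is a linear subspace of } X\},\qquad \operatorname{cone}(A):=\{ta\mid t\ge 0,\ a\in A\},$$ is nonempty. Then $P\cap\operatorname{qri}(\Omega)=\emptyset$ if and only if there exists a closed hyperplane $H$ that separates $P$ and $\Omega$ properly and does not contain $\Omega$; that is, there are $f\in X^*\setminus\{0\}$ and $\alpha\in\mathbb R$ such that $H=\{x\in X\mid f(x)=\alpha\}$, $f(p)\le\alpha\le f(w)$ for all $p\in P$ and $w\in\Omega$, $f(p_0)<f(w_0)$ for some $p_0\in P$ and $w_0\in\Omega$, and $\Omega\not\subset H$. -/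

import Mathlib

namespace PolySep

variable {X : Type*} [AddCommGroup X] [Module ℝ X] [TopologicalSpace X]

/-- The conic hull `{t a | t ≥ 0, a ∈ A}`. -/
def cone (A : Set X) : Set X := {y | ∃ t : ℝ, 0 ≤ t ∧ ∃ a ∈ A, y = t • a}

/-- The quasi-relative interior: all `x ∈ Ω` for which the closure of `cone (Ω - x)` is a
linear subspace. -/
def qri (Ω : Set X) : Set X :=
  {x | x ∈ Ω ∧ ∃ L : Submodule ℝ X, (L : Set X) = closure (cone ((fun w => w - x) '' Ω))}

/-- A convex polyhedron: the solution set of finitely many inequalities `f i x ≤ b i` with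
continuous linear functionals `f i`. -/
def IsConvexPolyhedron (P : Set X) : Prop :=
  ∃ (k : ℕ) (f : Fin k → (X →L[ℝ] ℝ)) (b : Fin k → ℝ), P = {x | ∀ i, f i x ≤ b i}

/-- A closed hyperplane: a level set of a nonzero continuous linear functional. -/
def IsClosedHyperplane (H : Set X) : Prop :=
  ∃ f : X →L[ℝ] ℝ, f ≠ 0 ∧ ∃ α : ℝ, H = {x | f x = α}

/-- `H` separates `A` and `B` properly: the sets lie in opposite closed half-spaces bounded by
`H = {x | f x = α}`, and `f a < f b` for at least one pair `a ∈ A`, `b ∈ B`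
(that is, `A` and `B` are not both contained in `H`). The choice of sides is
immaterial, since `(f, α)` may be replaced by `(-f, -α)`. -/
def SeparatesProperly (H A B : Set X) : Prop :=
  ∃ f : X →L[ℝ] ℝ, f ≠ 0 ∧ ∃ α : ℝ, H = {x | f x = α} ∧
    (∀ a ∈ A, f a ≤ α) ∧ (∀ b ∈ B, α ≤ f b) ∧ ∃ a ∈ A, ∃ b ∈ B, f a < f b

end PolySep

/-!
Sufficiency of separation is immediate: if `x ∈ P ∩ qri Ω` and `f ≤ α` on `P`, `α ≤ f` on `Ω`, then
`f x = α`, so `f` is nonnegative on `cone (Ω - x)`, hence on its closure; since that closure is a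
linear subspace, `f` vanishes there and `Ω` lies in the hyperplane.

For the converse, write `P = {x | ∀ i, f i x ≤ b i}`. The map `x ↦ (f i x - b i)ᵢ` sends `qri Ω`,
which is convex, onto a convex set `C ⊆ ℝᵏ` that misses the nonpositive orthant. The task is then
finite-dimensional (`exists_nonneg_weights_of_forall_exists_pos`): find weights `l ≥ 0` such that
`∑ i, l i * c i` is nonnegative on `C` and not identically zero there. In `L = span C`, the set `C`
and the polyhedral cone `D = {d ∈ L | d ≤ 0}` are disjoint convex sets, and `0 ∈ D` makes `C - D`
contain the spanning set `C`; so some nonzero functional on `L` is nonnegative on `C - D`. It is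
nonpositive on `D`, so Farkas' lemma writes it as a nonnegative combination of the coordinates, and
being nonzero on `L` it cannot vanish on all of `C`. Separating within `span C` is what yields a
hyperplane that does not contain `Ω`, and the polyhedrality of `P` enters through Farkas' lemma.

Pulled back to `X`, the weights give `f = ∑ i, l i • f i`, with `f ≤ ∑ i, l i * b i` on `P` and `≥` on
`qri Ω`. The last inequality extends to `Ω`, because every point of `Ω` is the limit of points of
`qri Ω` along a segment.
-/

namespace PolySep

/-! ### Finite-dimensional separation and Farkas' lemma -/

section FiniteDimensional

/-- **Farkas' lemma** in a real vector space without topology: a linear functional that is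
nonpositive wherever finitely many others are is a nonnegative combination of them. -/
theorem exists_nonneg_combination_of_forall_nonpos {V ι : Type*} [AddCommGroup V] [Module ℝ V]
    (s : Finset ι) (φ : ι → V →ₗ[ℝ] ℝ) (h : V →ₗ[ℝ] ℝ)
    (hφ : ∀ x, (∀ i ∈ s, φ i x ≤ 0) → h x ≤ 0) :
    ∃ l : ι → ℝ, (∀ i, 0 ≤ l i) ∧ ∀ x, h x = ∑ i ∈ s, l i * φ i x := by
  classical
  induction s using Finset.induction_on generalizing φ h with
  | empty =>
    refine ⟨0, fun _ => le_rfl, fun x => ?_⟩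
    have h1 := hφ x (by simp)
    have h2 := hφ (-x) (by simp)
    rw [map_neg] at h2
    simp only [Finset.sum_empty]
    linarith
  | insert j s hj ih =>
    by_cases hs : ∀ x, (∀ i ∈ s, φ i x ≤ 0) → h x ≤ 0
    · obtain ⟨l, hl, hlx⟩ := ih φ h hs
      refine ⟨fun i => if i = j then 0 else l i, fun i => ?_, fun x => ?_⟩
      · dsimp only
        split_ifs
        exacts [le_rfl, hl i]
      · rw [Finset.sum_insert hj, hlx x]
        simp only [if_true, zero_mul, zero_add]
        refine Finset.sum_congr rfl fun i hi => ?_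
        rw [if_neg (ne_of_mem_of_not_mem hi hj)]
    · push Not at hs
      obtain ⟨y, hy, hhy⟩ := hs
      have hjy : 0 < φ j y := by
        by_contra! hle
        refine absurd (hφ y fun i hi => ?_) (not_le.2 hhy)
        rcases Finset.mem_insert.1 hi with rfl | hi
        exacts [hle, hy i hi]
      -- Project along `y` onto the kernel of `φ j`; on that kernel the constraint `j` is void.
      set p : V → V := fun x => x - (φ j x / φ j y) • y with hp
      obtain ⟨l, hl, hlx⟩ := ih (fun i => φ i - (φ i y / φ j y) • φ j)
        (h - (h y / φ j y) • φ j) (fun x hx => by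
          have key : ∀ g : V →ₗ[ℝ] ℝ, (g - (g y / φ j y) • φ j) x = g (p x) := fun g => by
            simp only [hp, LinearMap.sub_apply, LinearMap.smul_apply, map_sub, map_smul,
              smul_eq_mul]
            ring
          rw [key]
          refine hφ _ fun i hi => ?_
          rcases Finset.mem_insert.1 hi with rfl | hi
          · rw [← key, LinearMap.sub_apply, LinearMap.smul_apply, div_self hjy.ne', one_smul,
              sub_self]
          · rw [← key]
            exact hx i hi)
      -- The coefficient of `φ j` is nonnegative because `h y > 0` and `φ i y ≤ 0` for `i ∈ s`.
      set m : ℝ := h y / φ j y - ∑ i ∈ s, l i * (φ i y / φ j y) with hm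
      have hm0 : 0 ≤ m := by
        have h1 : 0 ≤ h y / φ j y := div_nonneg hhy.le hjy.le
        have h2 : ∑ i ∈ s, l i * (φ i y / φ j y) ≤ 0 := Finset.sum_nonpos fun i hi =>
          mul_nonpos_of_nonneg_of_nonpos (hl i) (div_nonpos_of_nonpos_of_nonneg (hy i hi) hjy.le)
        linarith
      refine ⟨fun i => if i = j then m else l i, fun i => ?_, fun x => ?_⟩
      · dsimp only
        split_ifs
        exacts [hm0, hl i]
      · have hsum : ∑ i ∈ s, (if i = j then m else l i) * φ i x = ∑ i ∈ s, l i * φ i x :=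
          Finset.sum_congr rfl fun i hi => by rw [if_neg (ne_of_mem_of_not_mem hi hj)]
        have hx := hlx x
        simp only [LinearMap.sub_apply, LinearMap.smul_apply, smul_eq_mul, mul_sub,
          Finset.sum_sub_distrib, ← mul_assoc, ← Finset.sum_mul] at hx
        rw [Finset.sum_insert hj, hsum]
        dsimp only
        rw [if_pos rfl, hm, sub_mul]
        linarith

/-- In finite dimension, a convex set that misses the origin and spans the space lies in a closed
half-space bounded by a hyperplane through the origin. -/
theorem exists_ne_zero_forall_nonneg {V : Type*} [NormedAddCommGroup V] [NormedSpace ℝ V]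
    [FiniteDimensional ℝ V] {A : Set V} (hA : Convex ℝ A) (hne : A.Nonempty)
    (hspan : Submodule.span ℝ A = ⊤) (h0 : (0 : V) ∉ A) :
    ∃ h : V →L[ℝ] ℝ, h ≠ 0 ∧ ∀ a ∈ A, 0 ≤ h a := by
  -- The cone of positive multiples of `A` is full-dimensional even if `A` is not: `A` may lie in
  -- an affine hyperplane off the origin.
  have hK : Convex ℝ (ConvexCone.hull ℝ A : Set V) := (ConvexCone.hull ℝ A).convex
  have hAK : A ⊆ ConvexCone.hull ℝ A := ConvexCone.subset_hull
  have h0K : (0 : V) ∉ (ConvexCone.hull ℝ A : Set V) := fun h => by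
    obtain ⟨c, hc, y, hy, hcy⟩ := (ConvexCone.mem_hull_of_convex hA).1 h
    obtain rfl : y = 0 := (smul_eq_zero.1 hcy).resolve_left hc.ne'
    exact h0 hy
  have hint : (interior (ConvexCone.hull ℝ A : Set V)).Nonempty := by
    rw [hK.interior_nonempty_iff_affineSpan_eq_top,
      AffineSubspace.affineSpan_eq_top_iff_vectorSpan_eq_top_of_nonempty ℝ V V (hne.mono hAK),
      eq_top_iff, ← hspan, Submodule.span_le]
    intro a ha
    have h2 : (2 : ℝ) • a ∈ ConvexCone.hull ℝ A := (ConvexCone.hull ℝ A).smul_mem two_pos (hAK ha)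
    have := vsub_mem_vectorSpan ℝ h2 (hAK ha)
    rwa [vsub_eq_sub, two_smul, add_sub_cancel_right] at this
  obtain ⟨f, hf, hfK⟩ := geometric_hahn_banach_of_nonempty_interior_point hK
    (fun h => h0K (interior_subset h)) hint
  refine ⟨-f, neg_ne_zero.2 hf, fun a ha => ?_⟩
  have := hfK a (hAK ha)
  rw [map_zero] at this
  simpa using this

/-- Proper separation from the nonpositive orthant: if every point of a nonempty convex set `C`
has a positive coordinate, some nonnegative combination of the coordinates is nonnegative on `C`
and positive somewhere on `C`. -/
theorem exists_nonneg_weights_of_forall_exists_pos {ι : Type*} [Fintype ι] {C : Set (ι → ℝ)}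
    (hC : Convex ℝ C) (hne : C.Nonempty) (hpos : ∀ c ∈ C, ∃ i, 0 < c i) :
    ∃ l : ι → ℝ, (∀ i, 0 ≤ l i) ∧ (∀ c ∈ C, 0 ≤ ∑ i, l i * c i) ∧
      ∃ c ∈ C, 0 < ∑ i, l i * c i := by
  open scoped Pointwise in
  let L := Submodule.span ℝ C
  let C' : Set L := {x | (x : ι → ℝ) ∈ C}
  let D : Set L := {x | ∀ i, (x : ι → ℝ) i ≤ 0}
  have hC' : Convex ℝ C' := hC.linear_preimage L.subtype
  have hD : Convex ℝ D := by
    intro x hx y hy a b ha hb _ i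
    have h1 := mul_nonpos_of_nonneg_of_nonpos ha (hx i)
    have h2 := mul_nonpos_of_nonneg_of_nonpos hb (hy i)
    simpa using add_nonpos h1 h2
  have h0D : (0 : L) ∈ D := fun i => by simp
  have hC'ne : C'.Nonempty := by
    obtain ⟨c, hc⟩ := hne
    exact ⟨⟨c, Submodule.subset_span hc⟩, hc⟩
  have hC'span : Submodule.span ℝ C' = ⊤ := Submodule.span_span_coe_preimage
  have hsub : C' ⊆ C' - D := fun x hx => ⟨x, hx, 0, h0D, sub_zero x⟩
  have h0 : (0 : L) ∉ C' - D := by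
    rintro ⟨c, hc, d, hd, hcd⟩
    obtain rfl : c = d := sub_eq_zero.1 hcd
    obtain ⟨i, hi⟩ := hpos _ hc
    exact absurd (hd i) (not_le.2 hi)
  obtain ⟨h, hh0, hh⟩ := exists_ne_zero_forall_nonneg (hC'.sub hD) (hC'ne.mono hsub)
    (top_le_iff.1 (hC'span ▸ Submodule.span_mono hsub)) h0
  -- On the cone `D` the functional is bounded above by a value on `C`, hence nonpositive.
  have hhD : ∀ d ∈ D, h d ≤ 0 := by
    intro d hd
    obtain ⟨c, hc⟩ := hC'ne
    by_contra! hpos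
    have hc0 : 0 ≤ h c := hh c (hsub hc)
    have ht : 0 ≤ (h c + 1) / h d := by positivity
    have hdt : ((h c + 1) / h d) • d ∈ D := fun i => by
      simpa using mul_nonpos_of_nonneg_of_nonpos ht (hd i)
    have := hh _ ⟨c, hc, _, hdt, rfl⟩
    rw [map_sub, map_smul, smul_eq_mul, div_mul_cancel₀ _ hpos.ne'] at this
    linarith
  obtain ⟨l, hl, hlx⟩ := exists_nonneg_combination_of_forall_nonpos Finset.univ
    (fun i => (LinearMap.proj i : (ι → ℝ) →ₗ[ℝ] ℝ) ∘ₗ L.subtype) (h : L →ₗ[ℝ] ℝ)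
    (fun x hx => hhD x fun i => hx i (Finset.mem_univ i))
  have hlx' : ∀ x : L, h x = ∑ i, l i * (x : ι → ℝ) i := hlx
  refine ⟨l, hl, fun c hc => ?_, ?_⟩
  · rw [← hlx' ⟨c, Submodule.subset_span hc⟩]
    exact hh _ (hsub hc)
  · by_contra! hle
    refine hh0 (ContinuousLinearMap.coe_injective (LinearMap.ext_on hC'span fun x hx => ?_))
    exact le_antisymm ((hlx' x).trans_le (hle _ hx)) (hh _ (hsub hx))

end FiniteDimensional

/-! ### The quasi-relative interior -/

section Qri

variable {X : Type*} [AddCommGroup X] [Module ℝ X] [TopologicalSpace X]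

/-- A half-open segment from a point of `qri Ω` towards a point of `Ω` stays in `qri Ω`: the closed
cones of `Ω` at the two base points coincide. -/
theorem add_smul_mem_qri {Ω : Set X} (hΩ : Convex ℝ Ω) {x w : X} (hx : x ∈ qri Ω) (hw : w ∈ Ω)
    {a b : ℝ} (ha : 0 < a) (hb : 0 ≤ b) (hab : a + b = 1) : a • x + b • w ∈ qri Ω := by
  obtain ⟨hxΩ, L, hL⟩ := hx
  have hmem : ∀ v ∈ Ω, v - x ∈ L := fun v hv => by
    rw [← SetLike.mem_coe, hL]
    exact subset_closure ⟨1, zero_le_one, v - x, ⟨v, hv, rfl⟩, (one_smul _ _).symm⟩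
  have hz : ∀ v : X, v - (a • x + b • w) = (v - x) - b • (w - x) := fun v => by
    obtain rfl : a = 1 - b := by linarith
    module
  refine ⟨hΩ hxΩ hw ha.le hb hab, L, Set.Subset.antisymm ?_ ?_⟩
  · rw [hL]
    refine closure_mono ?_
    rintro _ ⟨t, ht, _, ⟨v, hv, rfl⟩, rfl⟩
    refine ⟨t / a, div_nonneg ht ha.le, _, ⟨a • v + b • w, hΩ hv hw ha.le hb hab, rfl⟩, ?_⟩
    -- Contracting `Ω` towards `w` by the factor `a` turns `v - x` into `a • (v - x)`.
    have : a • v + b • w - (a • x + b • w) = a • (v - x) := by module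
    dsimp only
    rw [this, smul_smul, div_mul_cancel₀ _ ha.ne']
  · refine closure_minimal ?_ (hL ▸ isClosed_closure)
    rintro _ ⟨t, -, _, ⟨v, hv, rfl⟩, rfl⟩
    dsimp only
    rw [hz]
    exact L.smul_mem _ (L.sub_mem (hmem v hv) (L.smul_mem _ (hmem w hw)))

theorem convex_qri {Ω : Set X} (hΩ : Convex ℝ Ω) : Convex ℝ (qri Ω) := by
  intro x hx y hy a b ha hb hab
  rcases ha.eq_or_lt with rfl | ha
  · obtain rfl : b = 1 := by linarith
    simpa using hy
  · exact add_smul_mem_qri hΩ hx hy.1 ha hb hab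

/-- A lower bound for a linear functional on a nonempty `qri Ω` is a lower bound on `Ω`. No
continuity is needed, as only segments are used. -/
theorem le_of_forall_qri_le {Ω : Set X} (hΩ : Convex ℝ Ω) (hne : (qri Ω).Nonempty)
    (f : X →ₗ[ℝ] ℝ) {α : ℝ} (hf : ∀ x ∈ qri Ω, α ≤ f x) {w : X} (hw : w ∈ Ω) : α ≤ f w := by
  obtain ⟨x, hx⟩ := hne
  have hlim : Filter.Tendsto (fun a : ℝ => a * f x + (1 - a) * f w)
      (nhdsWithin 0 (Set.Ioi 0)) (nhds (f w)) := by
    have : Continuous fun a : ℝ => a * f x + (1 - a) * f w := by fun_prop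
    simpa using (this.tendsto 0).mono_left nhdsWithin_le_nhds
  refine ge_of_tendsto hlim ?_
  filter_upwards [Ioo_mem_nhdsGT (zero_lt_one' ℝ)] with a ha
  simpa using hf _ (add_smul_mem_qri hΩ hx hw ha.1 (sub_nonneg.2 ha.2.le) (by ring))

/-- A continuous linear functional that attains its minimum over `Ω` at a point of `qri Ω` is
constant on `Ω`. -/
theorem eq_of_mem_qri_of_forall_le {Ω : Set X} {x : X} (hx : x ∈ qri Ω) (f : X →L[ℝ] ℝ)
    (hf : ∀ w ∈ Ω, f x ≤ f w) {w : X} (hw : w ∈ Ω) : f w = f x := by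
  obtain ⟨-, L, hL⟩ := hx
  have hnonneg : ∀ y ∈ L, 0 ≤ f y := by
    intro y hy
    rw [← SetLike.mem_coe, hL] at hy
    refine closure_minimal (t := {y | 0 ≤ f y}) ?_ (isClosed_Ici.preimage f.continuous) hy
    rintro _ ⟨t, ht, _, ⟨v, hv, rfl⟩, rfl⟩
    simpa using mul_nonneg ht (sub_nonneg.2 (hf v hv))
  have hwL : w - x ∈ L := by
    rw [← SetLike.mem_coe, hL]
    exact subset_closure ⟨1, zero_le_one, w - x, ⟨w, hw, rfl⟩, (one_smul _ _).symm⟩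
  have h1 := hnonneg _ (L.neg_mem hwL)
  rw [map_neg, map_sub] at h1
  linarith [hf w hw]

end Qri

end PolySep

open PolySep in
theorem theorem3p5 {X : Type*} [AddCommGroup X] [Module ℝ X] [TopologicalSpace X]
    [IsTopologicalAddGroup X] [ContinuousSMul ℝ X] [LocallyConvexSpace ℝ X]
    (P Ω : Set X) (hP : PolySep.IsConvexPolyhedron P) (hPne : P.Nonempty)
    (hΩ : Convex ℝ Ω) (hqri : (PolySep.qri Ω).Nonempty) :
    P ∩ PolySep.qri Ω = ∅ ↔
      ∃ H : Set X, PolySep.IsClosedHyperplane H ∧ ¬ Ω ⊆ H ∧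
        PolySep.SeparatesProperly H P Ω := by
  constructor
  · intro hdisj
    obtain ⟨k, f, b, rfl⟩ := hP
    obtain ⟨p, hp⟩ := hPne
    let g : X → Fin k → ℝ := fun x i => f i x - b i
    have hconv : Convex ℝ (g '' qri Ω) := by
      rintro _ ⟨x, hx, rfl⟩ _ ⟨y, hy, rfl⟩ s t hs ht hst
      refine ⟨_, convex_qri hΩ hx hy hs ht hst, funext fun i => ?_⟩
      obtain rfl : s = 1 - t := by linarith
      simp only [g, map_add, map_smul, smul_eq_mul, Pi.add_apply, Pi.smul_apply]
      ring
    obtain ⟨l, hl, hnonneg, _, ⟨x₀, hx₀, rfl⟩, hpos⟩ :=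
      exists_nonneg_weights_of_forall_exists_pos hconv (hqri.image g) (by
        rintro _ ⟨x, hx, rfl⟩
        by_contra! hle
        have : x ∈ {x | ∀ i, f i x ≤ b i} ∩ qri Ω := ⟨fun i => sub_nonpos.1 (hle i), hx⟩
        rwa [hdisj] at this)
    set F : X →L[ℝ] ℝ := ∑ i, l i • f i with hF
    set α : ℝ := ∑ i, l i * b i with hα
    have hFx : ∀ x, F x = ∑ i, l i * f i x := fun x => by simp [hF]
    have hFg : ∀ x, ∑ i, l i * g x i = F x - α := fun x => by
      simp only [g, mul_sub, Finset.sum_sub_distrib, hFx, hα]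
    have hP' : ∀ x ∈ {x | ∀ i, f i x ≤ b i}, F x ≤ α := fun x hx => by
      rw [hFx]
      exact Finset.sum_le_sum fun i _ => mul_le_mul_of_nonneg_left (hx i) (hl i)
    have hΩ' : ∀ w ∈ Ω, α ≤ F w := fun w hw =>
      le_of_forall_qri_le hΩ hqri (F : X →ₗ[ℝ] ℝ) (fun x hx => by
        have := hnonneg _ ⟨x, hx, rfl⟩
        rw [hFg] at this
        exact sub_nonneg.1 this) hw
    rw [hFg, sub_pos] at hpos
    have hlt : F p < F x₀ := (hP' p hp).trans_lt hpos
    have hF0 : F ≠ 0 := fun h => by simp [h] at hlt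
    exact ⟨{x | F x = α}, ⟨F, hF0, α, rfl⟩, fun h => hpos.ne' (h hx₀.1),
      F, hF0, α, rfl, hP', hΩ', p, hp, x₀, hx₀.1, hlt⟩
  · rintro ⟨H, -, hΩH, f, -, α, rfl, hfP, hfΩ, -⟩
    refine Set.eq_empty_of_forall_notMem fun x hx => hΩH fun w hw => ?_
    have hxα : f x = α := le_antisymm (hfP x hx.1) (hfΩ x hx.2.1)
    exact (eq_of_mem_qri_of_forall_le hx.2 f (fun v hv => hxα.trans_le (hfΩ v hv)) hw).trans hxα
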